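/- Theorem (Growth properties in the dual). Let $\mathbb{S}^n$ be the space of real symmetric $n\times n$ matrices with inner product $\langle X,Y\rangle=\mathrm{tr}(X^{\mathsf T}Y)$ and Frobenius norm $\|\cdot\|$, let $\mathbb{S}^n_+$ be the cone of positive semidefinite matrices, and let $\mathbb{R}^m\times\mathbb{S}^n$ carry the Euclidean product norm; $\mathrm{dist}(\cdot,S)$ is the distance to a set $S$. Let $C,A_1,\dots,A_m\in\mathbb{S}^n$ and $b\in\mathbb{R}^m$, put $\mathcal{A}(X)=(\langle A_1,X\rangle,\dots,\langle A_m,X\rangle)$ and $\mathcal{A}^*(y)=\sum_{i=1}^m y_iA_i$, and assume that $\mathcal{A}$ is surjective. Consider the semidefinite programs $$p^\star=\inf\{\langle C,X\rangle : \mathcal{A}(X)=b,\ X\in\mathbb{S}^n_+\},\qquad d^\star=\sup\{\langle b,y\rangle : \mathcal{A}^*(y)+Z=C,\ Z\in\mathbb{S}^n_+\},$$ with sets of optimal solutions $\Omega_{\mathrm P}\subseteq\mathbb{S}^n$ and $\Omega_{\mathrm D}\subseteq\mathbb{R}^m\times\mathbb{S}^n$. Suppose that strong duality $p^\star=d^\star$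 holds, and that $\bar X^\star\in\Omega_{\mathrm P}$ and $(\bar y^\star,\bar Z^\star)\in\Omega_{\mathrm D}$ satisfy dual strict complementarity, i.e. $\bar X^\star\in\mathrm{relint}\,\mathcal{N}_{(\mathbb{S}^n_+)^\circ}(-\bar Z^\star)$, the relative interior of the normal cone at $-\bar Z^\star$ of the polar cone $(\mathbb{S}^n_+)^\circ$ of $\mathbb{S}^n_+$. Let $f_{\mathrm D}(y,Z)=-\langle b,y\rangle+h(Z)$, where $h:\mathbb{S}^n\to\mathbb{R}\cup\{+\infty\}$ is either the indicator function of $\mathbb{S}^n_+$ (equal to $0$ on $\mathbb{S}^n_+$ and to $+\infty$ elsewhere) or the penalty function $h(Z)=\rho\max\{0,\lambda_{\max}(-Z)\}$ with $\rho>\mathrm{tr}(\bar X^\star)$. Then for every compact set $\mathcal{V}\subseteq\mathbb{R}^m\times\mathbb{S}^n$ that contains a point of $\Omega_{\mathrm D}$ there exist constants $\kappa,\gamma,\alpha>0$ such that, for all $(y,Z)\in\mathcal{V}$, $$f_{\mathrm D}(y,Z)+d^\star+\gamma\|C-\mathcal{A}^*(y)-Z\|\ \ge\ \kappa\,\mathrm{dist}^2((y,Z),\Omega_{\mathrm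 D}),$$ $$d^\star-\langle b,y\rangle+\gamma\|C-\mathcal{A}^*(y)-Z\|+\alpha\,\mathrm{dist}(Z,\mathbb{S}^n_+)\ \ge\ \kappa\,\mathrm{dist}^2((y,Z),\Omega_{\mathrm D}).$$ If moreover $\Omega_{\mathrm D}$ is compact, then the same conclusion holds with $\mathcal{V}$ any sublevel set $\{(y,Z)\in\mathbb{R}^m\times\mathbb{S}^n : f_{\mathrm D}(y,Z)\le\beta,\ \mathcal{A}^*(y)+Z=C\}$ with $\beta\in\mathbb{R}$. -/

import Mathlib

open scoped Matrix

noncomputable section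

/-- The space of real symmetric `n × n` matrices. -/
def SymMat (n : ℕ) : Type :=
  {X : Matrix (Fin n) (Fin n) ℝ // X ∈ selfAdjoint.submodule ℝ (Matrix (Fin n) (Fin n) ℝ)}

namespace SymMat

variable {n : ℕ}

instance : AddCommGroup (SymMat n) :=
  inferInstanceAs (AddCommGroup (selfAdjoint.submodule ℝ (Matrix (Fin n) (Fin n) ℝ)))

instance : Module ℝ (SymMat n) :=
  inferInstanceAs (Module ℝ (selfAdjoint.submodule ℝ (Matrix (Fin n) (Fin n) ℝ)))

/-- The underlying matrix. -/
def toMat (X : SymMat n) : Matrix (Fin n) (Fin n) ℝ := X.1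

theorem isHermitian (X : SymMat n) : X.toMat.IsHermitian := X.2

theorem ext_toMat {X Y : SymMat n} (h : X.toMat = Y.toMat) : X = Y := Subtype.ext h

theorem toMat_add (X Y : SymMat n) : (X + Y).toMat = X.toMat + Y.toMat := rfl

theorem toMat_smul (r : ℝ) (X : SymMat n) : (r • X).toMat = r • X.toMat := rfl

/-- The trace inner product `⟨X, Y⟩ = tr (Xᵀ Y)`; its norm is the Frobenius norm. -/
@[reducible] def innerCore (n : ℕ) : InnerProductSpace.Core ℝ (SymMat n) where
  inner X Y := Matrix.trace (X.toMatᵀ * Y.toMat)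
  conj_inner_symm X Y := by
    change Matrix.trace (Y.toMatᵀ * X.toMat) = _
    rw [← Matrix.trace_transpose]
    simp
  re_inner_nonneg X := by
    change 0 ≤ Matrix.trace (X.toMatᵀ * X.toMat)
    simp only [Matrix.trace, Matrix.diag, Matrix.mul_apply, Matrix.transpose_apply]
    exact Finset.sum_nonneg fun i _ => Finset.sum_nonneg fun j _ => mul_self_nonneg _
  add_left X Y Z := by
    change Matrix.trace ((X.toMat + Y.toMat)ᵀ * Z.toMat) = _
    simp [Matrix.add_mul]
  smul_left X Y r := by
    change Matrix.trace ((r • X.toMat)ᵀ * Y.toMat) = _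
    simp
  definite X h := by
    apply ext_toMat
    have h' : Matrix.trace (X.toMatᴴ * X.toMat) = 0 := by
      simpa [Matrix.conjTranspose_eq_transpose_of_trivial] using h
    exact Matrix.trace_conjTranspose_mul_self_eq_zero_iff.mp h'

instance : NormedAddCommGroup (SymMat n) := (innerCore n).toNormedAddCommGroup

instance : InnerProductSpace ℝ (SymMat n) := InnerProductSpace.ofCore (innerCore n).toCore

theorem inner_eq_trace (X Y : SymMat n) : inner ℝ X Y = Matrix.trace (X.toMatᵀ * Y.toMat) := rfl

/-- The cone of positive semidefinite matrices. -/
def psdCone (n : ℕ) : Set (SymMat n) := {X | X.toMat.PosSemidef}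

/-- The trace of a symmetric matrix. -/
def tr (X : SymMat n) : ℝ := X.toMat.trace

/-- The largest eigenvalue of a symmetric matrix. -/
def lamMax (X : SymMat n) : ℝ := ⨆ i, X.isHermitian.eigenvalues i

/-- The indicator function of the positive semidefinite cone. -/
def psdIndicator (Z : SymMat n) : EReal :=
  open scoped Classical in if Z ∈ psdCone n then 0 else ⊤

/-- The penalty function `Z ↦ ρ max {0, λ_max (-Z)}`. -/
def psdPenalty (ρ : ℝ) (Z : SymMat n) : EReal := ((ρ * max 0 (lamMax (-Z)) : ℝ) : EReal)

end SymMat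

section Cones

variable {E : Type*} [NormedAddCommGroup E] [InnerProductSpace ℝ E]

/-- The polar cone `K° = {y | ⟨y, x⟩ ≤ 0 for all x ∈ K}`. -/
def polarCone (K : Set E) : Set E := {y | ∀ x ∈ K, inner ℝ y x ≤ 0}

/-- The normal cone of a convex set `S` at a point `x` of `S`
(by convention empty if `x` is not in `S`). -/
def normalCone (S : Set E) (x : E) : Set E := {v | x ∈ S ∧ ∀ y ∈ S, inner ℝ v (y - x) ≤ 0}

end Cones

namespace SDP

variable {m n : ℕ}

/-- The dual variables `(y, Z)`, with the Euclidean norm `‖(y, Z)‖² = ‖y‖² + ‖Z‖²`. -/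
abbrev DualSpace (m n : ℕ) : Type := WithLp 2 (EuclideanSpace ℝ (Fin m) × SymMat n)

/-- The linear map `X ↦ (⟨A₁, X⟩, …, ⟨A_m, X⟩)`. -/
def opA (A : Fin m → SymMat n) (X : SymMat n) : EuclideanSpace ℝ (Fin m) :=
  WithLp.toLp 2 fun i => inner ℝ (A i) X

/-- The adjoint map `y ↦ ∑ i, y i • A i`. -/
def adjA (A : Fin m → SymMat n) (y : EuclideanSpace ℝ (Fin m)) : SymMat n := ∑ i, y i • A i

theorem inner_opA (A : Fin m → SymMat n) (X : SymMat n) (y : EuclideanSpace ℝ (Fin m)) :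
    inner ℝ (opA A X) y = inner ℝ X (adjA A y) := by
  simp [opA, adjA, PiLp.inner_apply, inner_sum, inner_smul_right, real_inner_comm]

/-- The feasible set of the primal problem: `𝒜 X = b`, `X ⪰ 0`. -/
def primalFeasible (A : Fin m → SymMat n) (b : EuclideanSpace ℝ (Fin m)) : Set (SymMat n) :=
  {X | opA A X = b ∧ X ∈ SymMat.psdCone n}

/-- The feasible set of the dual problem: `𝒜* y + Z = C`, `Z ⪰ 0`. -/
def dualFeasible (A : Fin m → SymMat n) (C : SymMat n) : Set (DualSpace m n) :=
  {w | adjA A w.fst + w.snd = C ∧ w.snd ∈ SymMat.psdCone n}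

/-- The primal optimal value `p⋆`, the infimum of `⟨C, X⟩` over primal feasible `X`. -/
def primalValue (A : Fin m → SymMat n) (b : EuclideanSpace ℝ (Fin m)) (C : SymMat n) : EReal :=
  ⨅ X ∈ primalFeasible A b, ((inner ℝ C X : ℝ) : EReal)

/-- The dual optimal value `d⋆`, the supremum of `⟨b, y⟩` over dual feasible `(y, Z)`. -/
def dualValue (A : Fin m → SymMat n) (b : EuclideanSpace ℝ (Fin m)) (C : SymMat n) : EReal :=
  ⨆ w ∈ dualFeasible A C, ((inner ℝ b w.fst : ℝ) : EReal)

/-- The set `Ω_P` of primal optimal solutions. -/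
def primalSol (A : Fin m → SymMat n) (b : EuclideanSpace ℝ (Fin m)) (C : SymMat n) :
    Set (SymMat n) :=
  {X | ((inner ℝ C X : ℝ) : EReal) = primalValue A b C ∧ X ∈ primalFeasible A b}

/-- The set `Ω_D` of dual optimal solutions. -/
def dualSol (A : Fin m → SymMat n) (b : EuclideanSpace ℝ (Fin m)) (C : SymMat n) :
    Set (DualSpace m n) :=
  {w | ((inner ℝ b w.fst : ℝ) : EReal) = dualValue A b C ∧ w ∈ dualFeasible A C}

/-- Strong duality: `p⋆ = d⋆`. -/
def StrongDuality (A : Fin m → SymMat n) (b : EuclideanSpace ℝ (Fin m)) (C : SymMat n) : Prop :=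
  primalValue A b C = dualValue A b C

/-- `(X, y, Z)` is a triple of optimal solutions satisfying dual strict complementarity:
`X` is in the relative interior of the normal cone of the polar of the psd cone at `-Z`. -/
def DualStrictCompl (A : Fin m → SymMat n) (b : EuclideanSpace ℝ (Fin m)) (C : SymMat n)
    (X : SymMat n) (y : EuclideanSpace ℝ (Fin m)) (Z : SymMat n) : Prop :=
  X ∈ primalSol A b C ∧ (WithLp.toLp 2 (y, Z) : DualSpace m n) ∈ dualSol A b C ∧
    X ∈ intrinsicInterior ℝ (normalCone (polarCone (SymMat.psdCone n)) (-Z))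

/-- The reformulated dual cost `f_D (y, Z) = -⟨b, y⟩ + h Z`. -/
def dualCost (b : EuclideanSpace ℝ (Fin m)) (h : SymMat n → EReal) (w : DualSpace m n) : EReal :=
  ((-inner ℝ b w.fst : ℝ) : EReal) + h w.snd

/-- The sublevel set `{(y, Z) | f_D (y, Z) ≤ β, 𝒜* y + Z = C}`. -/
def dualSublevel (A : Fin m → SymMat n) (b : EuclideanSpace ℝ (Fin m)) (C : SymMat n)
    (h : SymMat n → EReal) (β : ℝ) : Set (DualSpace m n) :=
  {w | dualCost b h w ≤ (β : EReal) ∧ adjA A w.fst + w.snd = C}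

/-- Both growth estimates hold on `V`, with common positive constants `κ`, `γ`, `α`. The values are
extended reals; the first estimate is trivial where `f_D = ⊤`. -/
def DualGrowthOn (A : Fin m → SymMat n) (b : EuclideanSpace ℝ (Fin m)) (C : SymMat n)
    (h : SymMat n → EReal) (V : Set (DualSpace m n)) : Prop :=
  ∃ κ γ α : ℝ, 0 < κ ∧ 0 < γ ∧ 0 < α ∧
    (∀ w ∈ V,
      ((κ * Metric.infDist w (dualSol A b C) ^ 2 : ℝ) : EReal) ≤
        dualCost b h w + dualValue A b C + ((γ * ‖C - adjA A w.fst - w.snd‖ : ℝ) : EReal)) ∧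
    (∀ w ∈ V,
      ((κ * Metric.infDist w (dualSol A b C) ^ 2 : ℝ) : EReal) ≤
        dualValue A b C - ((inner ℝ b w.fst : ℝ) : EReal)
          + ((γ * ‖C - adjA A w.fst - w.snd‖ : ℝ) : EReal)
          + ((α * Metric.infDist w.snd (SymMat.psdCone n) : ℝ) : EReal))

end SDP

end

/-!
Let `P` be the orthogonal projection onto the kernel of `Z̄`. Dual strict complementarity says that
`X̄ = X̄ P`, that `X̄ ⪰ c P` and that `Z̄ ⪰ μ (1 - P)` for some `c, μ > 0`
(`SymMat.exists_projector_of_mem_intrinsicInterior_normalCone`). In particular every feasible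
`(y, Z)` with `P Z = 0` is dual optimal, because by strong duality the gap `d⋆ - ⟨b, y⟩` equals
`⟨X̄, Z⟩ + ⟨X̄, C - 𝒜* y - Z⟩` (`SDP.dualityGap_eq`).

For `Z ⪰ 0` in a bounded set, the distance to these solutions is at most a multiple of
`‖C - 𝒜* y - Z‖ + ‖P Z‖` (`SDP.exists_dist_le_residual`): solve the linear equations
`𝒜* y + Z = C`, `P Z = 0` with a linear error bound, and repair the loss of positivity by moving
slightly towards `(ȳ, Z̄)`, which is positive definite on the range of `1 - P`. Since
`‖P Z‖² ≤ tr (P Z) tr Z` for `Z ⪰ 0`, and `c tr (P Z) ≤ ⟨X̄, Z⟩`, squaring gives quadratic growth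
(`SDP.exists_infDist_sq_le`). A general `Z` is replaced by its projection onto the cone, or, for the
penalty function, by `Z + ε I` with `ε = max {0, λ_max (-Z)}`; the cost of the replacement is
paid by the distance term, or by the slack `(ρ - tr X̄) ε`.

The estimates thus hold on every bounded set, and it remains to see that sublevel sets are bounded
when the solution set is (`SDP.exists_norm_le_of_mem_dualSublevel`). Growth on a large sphere bounds
the cost away from its minimum there, and convexity along rays from `(ȳ, Z̄)` makes the cost grow
linearly outside the sphere.
-/

noncomputable section

/-! ### Positive semidefinite matrices -/

namespace SDP

section MatrixLemmas

variable {ι : Type*} [Fintype ι] [DecidableEq ι]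

theorem exists_unitary_diagonalization {Z : Matrix ι ι ℝ} (hZ : Z.IsHermitian) :
    ∃ U : Matrix ι ι ℝ, U * Uᴴ = 1 ∧ Uᴴ * U = 1 ∧
      Z = U * Matrix.diagonal hZ.eigenvalues * Uᴴ := by
  refine ⟨hZ.eigenvectorUnitary, ?_, ?_, ?_⟩
  · exact Unitary.coe_mul_star_self hZ.eigenvectorUnitary
  · exact Unitary.coe_star_mul_self hZ.eigenvectorUnitary
  · conv_lhs => rw [hZ.spectral_theorem]
    rfl

theorem trace_mul_nonneg {X Z : Matrix ι ι ℝ} (hX : X.PosSemidef) (hZ : Z.PosSemidef) :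
    0 ≤ (X * Z).trace := by
  obtain ⟨B, rfl⟩ : ∃ B, Z = Bᴴ * B := by
    open scoped MatrixOrder in
    exact CStarAlgebra.nonneg_iff_eq_star_mul_self.mp hZ.nonneg
  rw [← Matrix.mul_assoc, Matrix.trace_mul_comm, ← Matrix.mul_assoc]
  exact (hX.mul_mul_conjTranspose_same B).trace_nonneg

/-- The projector `P` is the orthogonal projection onto the kernel of `Z`, and `μ` is the smallest
positive eigenvalue of `Z`. -/
theorem exists_kernel_projector {Z : Matrix ι ι ℝ} (hZ : Z.PosSemidef) :
    ∃ P : Matrix ι ι ℝ, P.IsHermitian ∧ P * P = P ∧ P * Z = 0 ∧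
      ∃ μ : ℝ, 0 < μ ∧ (Z - μ • (1 - P)).PosSemidef := by
  obtain ⟨U, h1, h2, h3⟩ := exists_unitary_diagonalization hZ.1
  set d := hZ.1.eigenvalues with hd
  have hd0 : ∀ i, 0 ≤ d i := fun i => hZ.eigenvalues_nonneg i
  obtain ⟨μ, hμ, hμd⟩ : ∃ μ : ℝ, 0 < μ ∧ ∀ i, d i ≠ 0 → μ ≤ d i := by
    rcases (Finset.univ.filter fun i => d i ≠ 0).eq_empty_or_nonempty with he | hne
    · refine ⟨1, one_pos, fun i hi => ?_⟩
      have : i ∈ (Finset.univ.filter fun i => d i ≠ 0) := by simp [hi]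
      simp [he] at this
    · obtain ⟨j, hj, hmin⟩ := Finset.exists_min_image _ d hne
      refine ⟨d j, lt_of_le_of_ne (hd0 j) (Ne.symm (by simpa using hj)), fun i hi => ?_⟩
      exact hmin i (by simp [hi])
  let e : ι → ℝ := fun i => if d i = 0 then 1 else 0
  have hmul : ∀ a c : ι → ℝ, (U * Matrix.diagonal a * Uᴴ) * (U * Matrix.diagonal c * Uᴴ) =
      U * Matrix.diagonal (fun i => a i * c i) * Uᴴ := by
    intro a c
    rw [← Matrix.diagonal_mul_diagonal]
    calc _ = U * Matrix.diagonal a * (Uᴴ * U) * Matrix.diagonal c * Uᴴ := by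
          simp only [Matrix.mul_assoc]
      _ = _ := by simp only [h2, Matrix.mul_one, Matrix.mul_assoc]
  refine ⟨U * Matrix.diagonal e * Uᴴ, ?_, ?_, ?_, μ, hμ, ?_⟩
  · exact Matrix.isHermitian_mul_mul_conjTranspose _ (Matrix.isHermitian_diagonal _)
  · rw [hmul]
    congr 3
    funext i
    simp only [e]
    split_ifs <;> simp
  · rw [h3, hmul]
    have : (fun i => e i * d i) = 0 := by
      funext i
      simp only [e]
      split_ifs with hi <;> simp [hi]
    rw [this]
    simp
  · have : Z - μ • (1 - U * Matrix.diagonal e * Uᴴ) =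
        U * Matrix.diagonal (fun i => d i - μ * (1 - e i)) * Uᴴ := by
      have h4 : Matrix.diagonal (fun i => d i - μ * (1 - e i)) =
          Matrix.diagonal d - μ • (1 - Matrix.diagonal e) := by
        ext i j
        by_cases hij : i = j
        · subst hij; simp
        · simp [hij]
      rw [h4]
      conv_lhs => rw [h3, ← h1]
      simp only [Matrix.mul_sub, Matrix.sub_mul, Matrix.mul_smul, Matrix.smul_mul, Matrix.mul_one]
    rw [this]
    apply Matrix.PosSemidef.mul_mul_conjTranspose_same
    rw [Matrix.posSemidef_diagonal_iff]
    intro i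
    simp only [e]
    split_ifs with hi
    · simp [hi]
    · have := hμd i hi
      linarith

theorem mul_projector_eq_zero {X Q : Matrix ι ι ℝ} (hX : X.PosSemidef) (hQ : Q.IsHermitian)
    (hQQ : Q * Q = Q) (h : (X * Q).trace = 0) : X * Q = 0 := by
  obtain ⟨B, rfl⟩ : ∃ B, X = Bᴴ * B := by
    open scoped MatrixOrder in
    exact CStarAlgebra.nonneg_iff_eq_star_mul_self.mp hX.nonneg
  have h1 : ((B * Q)ᴴ * (B * Q)).trace = 0 := by
    rw [Matrix.conjTranspose_mul, hQ.eq, Matrix.trace_mul_comm, ← h]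
    rw [Matrix.mul_assoc B, ← Matrix.mul_assoc Q, hQQ, Matrix.trace_mul_comm, Matrix.mul_assoc,
      Matrix.trace_mul_comm]
  rw [Matrix.mul_assoc, Matrix.trace_conjTranspose_mul_self_eq_zero_iff.mp h1, Matrix.mul_zero]

open scoped Matrix.Norms.Frobenius in
theorem frobenius_norm_sq_eq_trace (M : Matrix ι ι ℝ) : ‖M‖ ^ 2 = (Mᴴ * M).trace := by
  rw [Matrix.frobenius_norm_def, ← Real.sqrt_eq_rpow, Real.sq_sqrt (by positivity)]
  simp only [Matrix.trace, Matrix.diag, Matrix.mul_apply, Matrix.conjTranspose_apply]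
  rw [Finset.sum_comm]
  refine Finset.sum_congr rfl fun i _ => Finset.sum_congr rfl fun j _ => ?_
  simp [sq]

open scoped Matrix.Norms.Frobenius in
/-- For a positive semidefinite matrix, the off-diagonal block is controlled by the diagonal ones:
writing `Z = Bᴴ B`, one has `‖P Z‖ ≤ ‖B P‖ ‖B‖`. -/
theorem frobenius_norm_projector_mul_sq_le {P Z : Matrix ι ι ℝ} (hP : P.IsHermitian)
    (hPP : P * P = P) (hZ : Z.PosSemidef) : ‖P * Z‖ ^ 2 ≤ (P * Z).trace * Z.trace := by
  obtain ⟨B, rfl⟩ : ∃ B, Z = Bᴴ * B := by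
    open scoped MatrixOrder in
    exact CStarAlgebra.nonneg_iff_eq_star_mul_self.mp hZ.nonneg
  have h1 : ‖P * Bᴴ‖ ^ 2 = (P * (Bᴴ * B)).trace := by
    rw [frobenius_norm_sq_eq_trace, Matrix.trace_mul_comm, Matrix.conjTranspose_mul, hP.eq,
      Matrix.conjTranspose_conjTranspose, Matrix.trace_mul_comm, Matrix.mul_assoc,
      ← Matrix.mul_assoc P, hPP, Matrix.trace_mul_comm, Matrix.mul_assoc]
  rw [← h1, ← frobenius_norm_sq_eq_trace, ← mul_pow, ← Matrix.mul_assoc]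
  gcongr
  exact Matrix.frobenius_norm_mul _ _

theorem add_smul_one_posSemidef_iff {Z : Matrix ι ι ℝ} (hZ : (-Z).IsHermitian) (e : ℝ) :
    (Z + e • 1).PosSemidef ↔ ∀ i, hZ.eigenvalues i ≤ e := by
  constructor
  · intro h i
    have h1 := h.dotProduct_mulVec_nonneg (hZ.eigenvectorBasis i).ofLp
    have h2 : Z *ᵥ (hZ.eigenvectorBasis i).ofLp =
        -(hZ.eigenvalues i • (hZ.eigenvectorBasis i).ofLp) := by
      rw [← hZ.mulVec_eigenvectorBasis i, Matrix.neg_mulVec, neg_neg]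
    have h3 : star (hZ.eigenvectorBasis i).ofLp ⬝ᵥ (hZ.eigenvectorBasis i).ofLp = 1 := by
      have := hZ.eigenvectorBasis.orthonormal.1 i
      have h4 : inner ℝ (hZ.eigenvectorBasis i) (hZ.eigenvectorBasis i) = (1 : ℝ) := by
        rw [real_inner_self_eq_norm_sq, this]; norm_num
      rw [← h4, EuclideanSpace.inner_eq_star_dotProduct, dotProduct_comm]
    rw [Matrix.add_mulVec, h2, Matrix.smul_mulVec, Matrix.one_mulVec, dotProduct_add,
      dotProduct_neg, dotProduct_smul, dotProduct_smul, h3] at h1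
    simp only [smul_eq_mul, mul_one] at h1
    linarith
  · intro h
    obtain ⟨U, h1, h2, h3⟩ := exists_unitary_diagonalization hZ
    have : Z + e • 1 = U * Matrix.diagonal (fun i => e - hZ.eigenvalues i) * Uᴴ := by
      have h4 : Matrix.diagonal (fun i => e - hZ.eigenvalues i) =
          e • 1 - Matrix.diagonal hZ.eigenvalues := by
        ext i j
        by_cases hij : i = j
        · subst hij; simp
        · simp [hij]
      rw [h4, Matrix.mul_sub, Matrix.sub_mul, ← h3, sub_neg_eq_add, Matrix.mul_smul,
        Matrix.mul_one, Matrix.smul_mul, h1, add_comm]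
    rw [this]
    apply Matrix.PosSemidef.mul_mul_conjTranspose_same
    rw [Matrix.posSemidef_diagonal_iff]
    intro i
    have := h i
    linarith

end MatrixLemmas
end SDP

/-! ### The space of symmetric matrices and the positive semidefinite cone -/

namespace SymMat

variable {n : ℕ}

instance : FiniteDimensional ℝ (SymMat n) :=
  inferInstanceAs
    (FiniteDimensional ℝ (selfAdjoint.submodule ℝ (Matrix (Fin n) (Fin n) ℝ)))

/-- The symmetric matrix with a given Hermitian underlying matrix. -/
def ofHermitian {M : Matrix (Fin n) (Fin n) ℝ} (hM : M.IsHermitian) : SymMat n := ⟨M, hM⟩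

/-- The identity matrix as a symmetric matrix. -/
def idMat (n : ℕ) : SymMat n := ofHermitian Matrix.isHermitian_one

/-- The rank-one symmetric matrix `x xᵀ`. -/
def rankOne (x : Fin n → ℝ) : SymMat n :=
  ofHermitian (M := Matrix.vecMulVec x (star x)) (Matrix.posSemidef_vecMulVec_self_star x).1

theorem toMat_ofHermitian {M : Matrix (Fin n) (Fin n) ℝ} (hM : M.IsHermitian) :
    (ofHermitian hM).toMat = M := rfl

theorem toMat_idMat : (idMat n).toMat = 1 := rfl

theorem toMat_rankOne (x : Fin n → ℝ) : (rankOne x).toMat = Matrix.vecMulVec x (star x) := rfl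

theorem toMat_sub (X Y : SymMat n) : (X - Y).toMat = X.toMat - Y.toMat := rfl

theorem inner_eq_trace_mul (X Y : SymMat n) : inner ℝ X Y = (X.toMat * Y.toMat).trace := by
  rw [inner_eq_trace, ← Matrix.conjTranspose_eq_transpose_of_trivial, X.isHermitian.eq]

theorem inner_idMat (X : SymMat n) : inner ℝ X (idMat n) = X.tr := by
  rw [inner_eq_trace_mul, toMat_idMat, Matrix.mul_one, tr]

theorem inner_rankOne (x : Fin n → ℝ) (X : SymMat n) :
    inner ℝ X (rankOne x) = star x ⬝ᵥ (X.toMat *ᵥ x) := by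
  rw [inner_eq_trace_mul, toMat_rankOne, Matrix.mul_vecMulVec, Matrix.trace_vecMulVec,
    dotProduct_comm]

theorem zero_mem_psdCone : (0 : SymMat n) ∈ psdCone n := Matrix.PosSemidef.zero

theorem rankOne_mem_psdCone (x : Fin n → ℝ) : rankOne x ∈ psdCone n :=
  Matrix.posSemidef_vecMulVec_self_star x

theorem add_mem_psdCone {X Y : SymMat n} (hX : X ∈ psdCone n) (hY : Y ∈ psdCone n) :
    X + Y ∈ psdCone n := Matrix.PosSemidef.add hX hY

theorem smul_mem_psdCone {r : ℝ} (hr : 0 ≤ r) {X : SymMat n} (hX : X ∈ psdCone n) :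
    r • X ∈ psdCone n := Matrix.PosSemidef.smul hX hr

theorem inner_nonneg {X Y : SymMat n} (hX : X ∈ psdCone n) (hY : Y ∈ psdCone n) :
    0 ≤ inner ℝ X Y := by
  rw [inner_eq_trace_mul]
  exact SDP.trace_mul_nonneg hX hY

theorem mem_psdCone_of_inner_rankOne_nonneg {X : SymMat n}
    (h : ∀ x, 0 ≤ inner ℝ X (rankOne x)) : X ∈ psdCone n :=
  Matrix.PosSemidef.of_dotProduct_mulVec_nonneg X.isHermitian fun x => by
    rw [← inner_rankOne]; exact h x

theorem norm_rankOne (x : Fin n → ℝ) : ‖rankOne x‖ = star x ⬝ᵥ x := by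
  have h0 : 0 ≤ star x ⬝ᵥ x := dotProduct_star_self_nonneg x
  rw [← sq_eq_sq₀ (norm_nonneg _) h0, ← real_inner_self_eq_norm_sq, inner_rankOne,
    toMat_rankOne, Matrix.vecMulVec_mulVec]
  simp [dotProduct_smul, sq]

/-- The quadratic form of `Z` at `x` is `⟨Z, x xᵀ⟩`, hence at least `-‖Z‖ ‖x xᵀ‖`. -/
theorem add_smul_idMat_mem_psdCone {Z : SymMat n} {e : ℝ} (he : ‖Z‖ ≤ e) :
    Z + e • idMat n ∈ psdCone n := by
  refine mem_psdCone_of_inner_rankOne_nonneg fun x => ?_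
  have h1 : inner ℝ (idMat n) (rankOne x) = ‖rankOne x‖ := by
    rw [inner_rankOne, toMat_idMat, Matrix.one_mulVec, norm_rankOne]
  rw [inner_add_left, real_inner_smul_left, h1]
  have h2 := (abs_le.mp (abs_real_inner_le_norm Z (rankOne x))).1
  have h3 := mul_le_mul_of_nonneg_right he (norm_nonneg (rankOne x))
  linarith

/-- Nonnegativity of `e` covers the case `n = 0`, where `lamMax` is a supremum over the
empty set. -/
theorem lamMax_neg_le_iff {Z : SymMat n} {e : ℝ} (he : 0 ≤ e) :
    lamMax (-Z) ≤ e ↔ Z + e • idMat n ∈ psdCone n := by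
  change _ ↔ (Z.toMat + e • (1 : Matrix (Fin n) (Fin n) ℝ)).PosSemidef
  rw [SDP.add_smul_one_posSemidef_iff (Z := Z.toMat) (-Z).isHermitian e]
  constructor
  · intro h i
    exact (le_ciSup (Set.finite_range _).bddAbove i).trans h
  · intro h
    exact Real.iSup_le h he

theorem mem_psdCone_of_mem_normalCone {V Z : SymMat n}
    (h : V ∈ normalCone (polarCone (psdCone n)) (-Z)) : V ∈ psdCone n ∧ inner ℝ V Z = 0 := by
  obtain ⟨hZ, hV⟩ := h
  constructor
  · refine mem_psdCone_of_inner_rankOne_nonneg fun x => ?_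
    -- Testing the normal cone inequality at `-Z - x xᵀ` isolates the quadratic form of `V` at `x`.
    have hmem : -Z - rankOne x ∈ polarCone (psdCone n) := by
      intro Y hY
      have h1 := hZ Y hY
      have h2 := inner_nonneg (rankOne_mem_psdCone x) hY
      rw [inner_sub_left]
      linarith
    have := hV _ hmem
    simp only [sub_sub_cancel_left, inner_neg_right] at this
    linarith
  -- The polar cone contains `0` and `-2 Z`, on both sides of `-Z`, so the pairing vanishes.
  · have h0 : (0 : SymMat n) ∈ polarCone (psdCone n) := fun Y _ => by simp
    have h2 : (2 : ℝ) • (-Z) ∈ polarCone (psdCone n) := by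
      intro Y hY
      have := hZ Y hY
      rw [real_inner_smul_left]
      linarith
    have h3 := hV _ h0
    have h4 := hV _ h2
    rw [inner_sub_right, inner_smul_right, inner_neg_right] at h4
    simp only [sub_neg_eq_add, zero_add] at h3
    linarith

theorem mem_normalCone_of_mem_psdCone {V Z : SymMat n}
    (hZ : -Z ∈ polarCone (psdCone n)) (hV : V ∈ psdCone n) (hVZ : inner ℝ V Z = 0) :
    V ∈ normalCone (polarCone (psdCone n)) (-Z) := by
  refine ⟨hZ, fun Y hY => ?_⟩
  have := hY V hV
  rw [sub_neg_eq_add, inner_add_right, hVZ, real_inner_comm]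
  linarith

end SymMat

/-! ### Strict complementarity -/

/-- A point of the relative interior of a set can be moved slightly away from any other point
of the set without leaving the set. -/
theorem exists_pos_add_smul_sub_mem_of_mem_intrinsicInterior {E : Type*} [NormedAddCommGroup E]
    [NormedSpace ℝ E] {S : Set E} {x p : E} (hx : x ∈ intrinsicInterior ℝ S) (hp : p ∈ S) :
    ∃ s : ℝ, 0 < s ∧ x + s • (x - p) ∈ S := by
  obtain ⟨y, hy, rfl⟩ := mem_intrinsicInterior.mp hx
  rw [mem_interior_iff_mem_nhds, Metric.mem_nhds_iff] at hy
  obtain ⟨ε, hε, hball⟩ := hy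
  have hpos : 0 < ‖(y : E) - p‖ + 1 := by positivity
  refine ⟨ε / 2 / (‖(y : E) - p‖ + 1), by positivity, ?_⟩
  set s := ε / 2 / (‖(y : E) - p‖ + 1) with hs
  have hmem : (y : E) + s • ((y : E) - p) ∈ affineSpan ℝ S := by
    have := AffineSubspace.smul_vsub_vadd_mem (affineSpan ℝ S) s y.2
      (subset_affineSpan ℝ S hp) y.2
    simpa [add_comm] using this
  have : (⟨_, hmem⟩ : affineSpan ℝ S) ∈ Metric.ball y ε := by
    rw [Metric.mem_ball, Subtype.dist_eq, dist_eq_norm, add_sub_cancel_left, norm_smul,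
      Real.norm_of_nonneg (by positivity), hs, div_mul_eq_mul_div, div_lt_iff₀ hpos]
    nlinarith [norm_nonneg ((y : E) - p)]
  exact hball this

namespace SymMat

variable {n : ℕ}

/-- Dual strict complementarity in concrete terms: for `P` the orthogonal projection onto the
kernel of `Z`, the matrix `X` lives on the range of `P` and is positive definite there, while `Z`
is positive definite on the range of `1 - P`. -/
theorem exists_projector_of_mem_intrinsicInterior_normalCone {X Z : SymMat n}
    (hZ : Z ∈ psdCone n)
    (hX : X ∈ intrinsicInterior ℝ (normalCone (polarCone (psdCone n)) (-Z))) :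
    ∃ P : SymMat n, P.toMat * P.toMat = P.toMat ∧ P.toMat * Z.toMat = 0 ∧
      X.toMat * P.toMat = X.toMat ∧
      (∃ c : ℝ, 0 < c ∧ X - c • P ∈ psdCone n) ∧
      ∃ μ : ℝ, 0 < μ ∧ Z - μ • (idMat n - P) ∈ psdCone n := by
  obtain ⟨P, hP, hPP, hPZ, μ, hμ, hZμ⟩ := SDP.exists_kernel_projector hZ
  obtain ⟨hXpsd, hXZ⟩ := mem_psdCone_of_mem_normalCone (intrinsicInterior_subset hX)
  refine ⟨ofHermitian hP, hPP, hPZ, ?_, ?_, μ, hμ, hZμ⟩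
  · have hQ : (1 - P).IsHermitian := Matrix.isHermitian_one.sub hP
    have hQQ : (1 - P) * (1 - P) = 1 - P := by
      simp [Matrix.mul_sub, Matrix.sub_mul, hPP]
    have hQpsd : (1 - P).PosSemidef := by
      have := Matrix.posSemidef_conjTranspose_mul_self (1 - P)
      rwa [hQ.eq, hQQ] at this
    have h1 := SDP.trace_mul_nonneg hXpsd hQpsd
    have h2 := SDP.trace_mul_nonneg hXpsd hZμ
    rw [inner_eq_trace_mul] at hXZ
    rw [Matrix.mul_sub, Matrix.trace_sub, hXZ, Matrix.mul_smul, Matrix.trace_smul,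
      smul_eq_mul] at h2
    have h3 : (X.toMat * (1 - P)).trace = 0 := by nlinarith
    have h4 := SDP.mul_projector_eq_zero hXpsd hQ hQQ h3
    rw [Matrix.mul_sub, Matrix.mul_one, sub_eq_zero] at h4
    exact h4.symm
  · have hPpsd : ofHermitian hP ∈ psdCone n := by
      have := Matrix.posSemidef_conjTranspose_mul_self P
      rwa [hP.eq, hPP] at this
    have hPmem := mem_normalCone_of_mem_psdCone (intrinsicInterior_subset hX).1 hPpsd
      (by rw [inner_eq_trace_mul, toMat_ofHermitian, hPZ, Matrix.trace_zero])
    -- Moving from `X` away from `P` stays in the normal cone: `(1 + s) X - s P ⪰ 0`.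
    obtain ⟨s, hs, hmem⟩ := exists_pos_add_smul_sub_mem_of_mem_intrinsicInterior hX hPmem
    refine ⟨s / (1 + s), by positivity, ?_⟩
    have h1 := smul_mem_psdCone (r := (1 + s)⁻¹) (by positivity)
      (mem_psdCone_of_mem_normalCone hmem).1
    convert h1 using 1
    have : (1 + s) ≠ 0 := by positivity
    rw [smul_add, smul_sub, smul_sub, smul_smul, smul_smul, div_eq_inv_mul, add_sub,
      ← add_smul, ← mul_one_add, inv_mul_cancel₀ this, one_smul]

end SymMat

/-! ### Error bounds and quadratic growth -/

/-- A system of linear equations has a linear error bound: every right-hand side in the range has a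
preimage of comparable norm. -/
theorem LinearMap.exists_forall_exists_norm_le {E F : Type*} [NormedAddCommGroup E]
    [NormedSpace ℝ E] [FiniteDimensional ℝ E] [NormedAddCommGroup F] [NormedSpace ℝ F]
    (f : E →ₗ[ℝ] F) : ∃ K : ℝ, 0 < K ∧ ∀ v, ∃ u, f u = f v ∧ ‖u‖ ≤ K * ‖f v‖ := by
  obtain ⟨g, hg⟩ := f.rangeRestrict.exists_rightInverse_of_surjective f.range_rangeRestrict
  obtain ⟨K, hK, hb⟩ := g.toContinuousLinearMap.bound
  refine ⟨K, hK, fun v => ⟨g (f.rangeRestrict v), ?_, hb _⟩⟩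
  have := LinearMap.congr_fun hg (f.rangeRestrict v)
  exact congrArg Subtype.val this

theorem LinearMap.exists_forall_norm_le {E F : Type*} [NormedAddCommGroup E]
    [NormedSpace ℝ E] [FiniteDimensional ℝ E] [NormedAddCommGroup F] [NormedSpace ℝ F]
    (f : E →ₗ[ℝ] F) : ∃ K : ℝ, 0 < K ∧ ∀ v, ‖f v‖ ≤ K * ‖v‖ :=
  f.toContinuousLinearMap.bound

theorem WithLp.norm_snd_le_of_L2 {E F : Type*} [NormedAddCommGroup E] [NormedAddCommGroup F]
    (w : WithLp 2 (E × F)) : ‖w.snd‖ ≤ ‖w‖ := by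
  rw [WithLp.prod_norm_eq_of_L2]
  exact Real.le_sqrt_of_sq_le (le_add_of_nonneg_left (sq_nonneg _))

namespace SDP

open SymMat

variable {m n : ℕ}

/-- The linear map `(y, Z) ↦ 𝒜* y + Z`. -/
def constraintMap (A : Fin m → SymMat n) : DualSpace m n →ₗ[ℝ] SymMat n where
  toFun w := adjA A w.fst + w.snd
  map_add' v w := by
    simp only [adjA, WithLp.add_fst, WithLp.add_snd, PiLp.add_apply, add_smul,
      Finset.sum_add_distrib]
    abel
  map_smul' r w := by
    simp [adjA, smul_smul, Finset.smul_sum]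

theorem constraintMap_apply (A : Fin m → SymMat n) (w : DualSpace m n) :
    constraintMap A w = adjA A w.fst + w.snd := rfl

/-- The linear map `(y, Z) ↦ P Z`. -/
def faceMap (m : ℕ) (P : SymMat n) : DualSpace m n →ₗ[ℝ] Matrix (Fin n) (Fin n) ℝ where
  toFun w := P.toMat * w.snd.toMat
  map_add' v w := by rw [WithLp.add_snd, toMat_add, Matrix.mul_add]
  map_smul' r w := by rw [WithLp.smul_snd, toMat_smul, Matrix.mul_smul]; rfl

/-- If `Z` vanishes on the range of `P` and is positive semidefinite up to an error `δ`, then a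
convex combination with a matrix that is at least `μ` on the range of `1 - P` repairs it. -/
theorem add_smul_sub_mem_psdCone_of_face {P Z Z₀ : SymMat n} {δ μ : ℝ} (hδ : 0 ≤ δ) (hμ : 0 < μ)
    (hPP : P.toMat * P.toMat = P.toMat) (hPZ : P.toMat * Z.toMat = 0)
    (hZ : Z + δ • idMat n ∈ psdCone n) (hZ₀ : Z₀ - μ • (idMat n - P) ∈ psdCone n) :
    Z + (δ / (δ + μ)) • (Z₀ - Z) ∈ psdCone n := by
  have hZP : Z.toMat * P.toMat = 0 := by
    have := congrArg Matrix.conjTranspose hPZ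
    rwa [Matrix.conjTranspose_mul, Z.isHermitian.eq, P.isHermitian.eq,
      Matrix.conjTranspose_zero] at this
  -- Conjugating `Z + δ I ⪰ 0` by `1 - P` leaves `Z` unchanged and turns `I` into `1 - P`.
  have h1 : Z + δ • (idMat n - P) ∈ psdCone n := by
    have h2 := Matrix.PosSemidef.mul_mul_conjTranspose_same hZ (1 - P.toMat)
    have h3 : (1 - P.toMat) * (Z + δ • idMat n).toMat * (1 - P.toMat)ᴴ =
        (Z + δ • (idMat n - P)).toMat := by
      rw [Matrix.conjTranspose_sub, Matrix.conjTranspose_one, P.isHermitian.eq, toMat_add,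
        toMat_add, toMat_smul, toMat_smul, toMat_sub, toMat_idMat]
      simp only [Matrix.mul_add, Matrix.add_mul, Matrix.mul_sub, Matrix.sub_mul, hPZ, hZP,
        Matrix.mul_smul, Matrix.smul_mul, Matrix.mul_one, Matrix.one_mul, hPP]
      simp
    rw [h3] at h2
    exact h2
  have hpos : 0 < δ + μ := by positivity
  have h4 := add_mem_psdCone (smul_mem_psdCone (r := μ / (δ + μ)) (by positivity) h1)
    (smul_mem_psdCone (r := δ / (δ + μ)) (by positivity) hZ₀)
  convert h4 using 1
  have h5 : μ / (δ + μ) = 1 - δ / (δ + μ) := by field_simp; ring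
  have h6 : μ / (δ + μ) * δ = δ / (δ + μ) * μ := by ring
  rw [h5] at h6 ⊢
  have h7 : (δ / (δ + μ) * μ - (1 - δ / (δ + μ)) * δ) • (idMat n - P) = 0 := by
    rw [h6, sub_self, zero_smul]
  rw [← sub_eq_zero, ← h7]
  module

open scoped Matrix.Norms.Frobenius in
/-- Bounded linear regularity of the affine constraint and the face `{Z ⪰ 0 | P Z = 0}`, thanks to
the point `w₀` of the affine constraint that lies in the relative interior of the face. -/
theorem exists_dist_le_residual {A : Fin m → SymMat n} {C P : SymMat n} {w₀ : DualSpace m n}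
    {μ : ℝ} (hμ : 0 < μ) (hPP : P.toMat * P.toMat = P.toMat)
    (hw₀ : constraintMap A w₀ = C) (hPw₀ : P.toMat * w₀.snd.toMat = 0)
    (hZ₀ : w₀.snd - μ • (idMat n - P) ∈ psdCone n) (R : ℝ) :
    ∃ K : ℝ, 0 < K ∧ ∀ w : DualSpace m n, ‖w‖ ≤ R → w.snd ∈ psdCone n →
      ∃ v : DualSpace m n, constraintMap A v = C ∧ v.snd ∈ psdCone n ∧
        P.toMat * v.snd.toMat = 0 ∧
        dist w v ≤ K * (‖constraintMap A w - C‖ + ‖P.toMat * w.snd.toMat‖) := by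
  obtain ⟨K, hK, hbound⟩ := ((constraintMap A).prod (faceMap m P)).exists_forall_exists_norm_le
  refine ⟨K * (2 + (|R| + ‖w₀‖) / μ), by positivity, fun w hwR hw => ?_⟩
  obtain ⟨u, hu, hub⟩ := hbound (w - w₀)
  have hL : ∀ v : DualSpace m n, (constraintMap A).prod (faceMap m P) v =
      (constraintMap A v, P.toMat * v.snd.toMat) := fun _ => rfl
  have hLw : (constraintMap A).prod (faceMap m P) (w - w₀) =
      (constraintMap A w - C, P.toMat * w.snd.toMat) := by
    rw [hL, map_sub, hw₀, WithLp.sub_snd, toMat_sub, Matrix.mul_sub, hPw₀, sub_zero]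
  rw [hLw, hL, Prod.mk.injEq] at hu
  rw [hLw] at hub
  obtain ⟨hu1, hu2⟩ := hu
  set δ := K * (‖constraintMap A w - C‖ + ‖P.toMat * w.snd.toMat‖) with hδ
  have hδ0 : 0 ≤ δ := by positivity
  have huδ : ‖u‖ ≤ δ := by
    refine hub.trans (mul_le_mul_of_nonneg_left ?_ hK.le)
    rw [Prod.norm_mk]
    exact max_le (le_add_of_nonneg_right (norm_nonneg _)) (le_add_of_nonneg_left (norm_nonneg _))
  have hPu : P.toMat * (w - u).snd.toMat = 0 := by
    rw [WithLp.sub_snd, toMat_sub, Matrix.mul_sub, hu2, sub_self]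
  have hpsd : (w - u).snd + δ • idMat n ∈ psdCone n := by
    have h1 := add_smul_idMat_mem_psdCone (Z := -u.snd) (e := δ)
      (by rw [norm_neg]; exact (WithLp.norm_snd_le_of_L2 u).trans huδ)
    have h2 := add_mem_psdCone hw h1
    rwa [← add_assoc, ← sub_eq_add_neg] at h2
  have hpos : 0 < δ + μ := by positivity
  refine ⟨(w - u) + (δ / (δ + μ)) • (w₀ - (w - u)), ?_, ?_, ?_, ?_⟩
  · simp only [map_add, map_sub, map_smul, hu1, hw₀]
    simp
  · exact add_smul_sub_mem_psdCone_of_face hδ0 hμ hPP hPu hpsd hZ₀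
  · rw [WithLp.add_snd, WithLp.smul_snd, WithLp.sub_snd w₀, toMat_add, toMat_smul, toMat_sub,
      Matrix.mul_add, Matrix.mul_smul, Matrix.mul_sub, hPu, hPw₀]
    simp
  · have ht0 : 0 ≤ δ / (δ + μ) := by positivity
    have ht1 : δ / (δ + μ) ≤ 1 := by rw [div_le_one hpos]; linarith
    have ht2 : δ / (δ + μ) ≤ δ / μ := by gcongr; linarith
    have hvec : w - ((w - u) + (δ / (δ + μ)) • (w₀ - (w - u))) =
        (1 - δ / (δ + μ)) • u + (δ / (δ + μ)) • (w - w₀) := by module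
    rw [dist_eq_norm, hvec]
    calc _ ≤ ‖(1 - δ / (δ + μ)) • u‖ + ‖(δ / (δ + μ)) • (w - w₀)‖ := norm_add_le _ _
      _ ≤ 1 * δ + δ / μ * (|R| + ‖w₀‖) := by
        rw [norm_smul, norm_smul, Real.norm_of_nonneg ht0,
          Real.norm_of_nonneg (sub_nonneg.mpr ht1)]
        have h3 : ‖w - w₀‖ ≤ |R| + ‖w₀‖ :=
          (norm_sub_le _ _).trans (by gcongr; exact hwR.trans (le_abs_self R))
        gcongr
        linarith
      _ ≤ δ * (2 + (|R| + ‖w₀‖) / μ) := by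
        have : δ / μ * (|R| + ‖w₀‖) = δ * ((|R| + ‖w₀‖) / μ) := by ring
        rw [this]
        linarith
      _ = _ := by rw [hδ]; ring

open scoped Matrix.Norms.Frobenius in
theorem exists_frobenius_norm_projector_mul_sq_le {X P : SymMat n} {c : ℝ} (hc : 0 < c)
    (hPP : P.toMat * P.toMat = P.toMat) (hX : X - c • P ∈ psdCone n) (R : ℝ) :
    ∃ K : ℝ, 0 < K ∧ ∀ Z ∈ psdCone n, ‖Z‖ ≤ R → ‖P.toMat * Z.toMat‖ ^ 2 ≤ K * inner ℝ X Z := by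
  refine ⟨c⁻¹ * (|R| * ‖idMat n‖ + 1), by positivity, fun Z hZ hZR => ?_⟩
  have h1 := frobenius_norm_projector_mul_sq_le P.isHermitian hPP hZ
  have h2 := inner_nonneg hX hZ
  rw [inner_sub_left, real_inner_smul_left] at h2
  have hP : 0 ≤ inner ℝ P Z := by
    refine inner_nonneg ?_ hZ
    have := Matrix.posSemidef_conjTranspose_mul_self P.toMat
    rwa [P.isHermitian.eq, hPP] at this
  have h3 : Z.toMat.trace ≤ |R| * ‖idMat n‖ + 1 := by
    have h4 := real_inner_le_norm Z (idMat n)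
    rw [inner_idMat] at h4
    have h5 : ‖Z‖ * ‖idMat n‖ ≤ |R| * ‖idMat n‖ := by
      gcongr
      exact hZR.trans (le_abs_self R)
    change Z.tr ≤ _
    linarith
  rw [← inner_eq_trace_mul] at h1
  have h6 : inner ℝ P Z ≤ c⁻¹ * inner ℝ X Z := by
    rw [inv_mul_eq_div, le_div_iff₀ hc]
    linarith
  calc _ ≤ _ := h1
    _ ≤ inner ℝ P Z * (|R| * ‖idMat n‖ + 1) := by gcongr
    _ ≤ c⁻¹ * inner ℝ X Z * (|R| * ‖idMat n‖ + 1) := by gcongr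
    _ = _ := by ring

open scoped Matrix.Norms.Frobenius in
/-- Quadratic growth at points with a positive semidefinite matrix part. The square of the residual
`‖P Z‖` is controlled by `⟨X, Z⟩`, and the square of a bounded residual by the residual. -/
theorem exists_dist_sq_le_of_mem_psdCone {A : Fin m → SymMat n} {C X P : SymMat n}
    {w₀ : DualSpace m n} {c μ : ℝ} (hc : 0 < c) (hμ : 0 < μ)
    (hPP : P.toMat * P.toMat = P.toMat) (hX : X - c • P ∈ psdCone n)
    (hw₀ : constraintMap A w₀ = C) (hPw₀ : P.toMat * w₀.snd.toMat = 0)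
    (hZ₀ : w₀.snd - μ • (idMat n - P) ∈ psdCone n) (R : ℝ) :
    ∃ K : ℝ, 0 < K ∧ ∀ w : DualSpace m n, ‖w‖ ≤ R → w.snd ∈ psdCone n →
      ∃ v : DualSpace m n, constraintMap A v = C ∧ v.snd ∈ psdCone n ∧
        P.toMat * v.snd.toMat = 0 ∧
        dist w v ^ 2 ≤ K * (inner ℝ X w.snd + ‖constraintMap A w - C‖) := by
  obtain ⟨K₁, hK₁, h1⟩ := exists_dist_le_residual hμ hPP hw₀ hPw₀ hZ₀ R
  obtain ⟨K₂, hK₂, h2⟩ := exists_frobenius_norm_projector_mul_sq_le hc hPP hX R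
  obtain ⟨K₃, hK₃, h3⟩ := (constraintMap A).exists_forall_norm_le
  refine ⟨K₁ ^ 2 * (2 * (K₃ * |R| + ‖C‖) + 2 * K₂), by positivity, fun w hwR hw => ?_⟩
  obtain ⟨v, hv1, hv2, hv3, hv4⟩ := h1 w hwR hw
  refine ⟨v, hv1, hv2, hv3, ?_⟩
  set r := ‖constraintMap A w - C‖ with hr
  set p := ‖P.toMat * w.snd.toMat‖ with hp
  have hr0 : 0 ≤ r := norm_nonneg _
  have hp2 : p ^ 2 ≤ K₂ * inner ℝ X w.snd :=
    h2 _ hw ((WithLp.norm_snd_le_of_L2 w).trans hwR)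
  have hX0 : 0 ≤ inner ℝ X w.snd := by
    have : 0 ≤ K₂ * inner ℝ X w.snd := (sq_nonneg p).trans hp2
    exact nonneg_of_mul_nonneg_right this hK₂
  have hrb : r ≤ K₃ * |R| + ‖C‖ := by
    refine (norm_sub_le _ _).trans ?_
    gcongr
    refine (h3 w).trans ?_
    gcongr
    exact hwR.trans (le_abs_self R)
  have hr2 : r ^ 2 ≤ (K₃ * |R| + ‖C‖) * r := by
    rw [sq]; gcongr
  calc dist w v ^ 2 ≤ (K₁ * (r + p)) ^ 2 := by gcongr
    _ = K₁ ^ 2 * (r + p) ^ 2 := by ring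
    _ ≤ K₁ ^ 2 * (2 * r ^ 2 + 2 * p ^ 2) := by
      gcongr
      nlinarith [sq_nonneg (r - p)]
    _ ≤ K₁ ^ 2 * (2 * ((K₃ * |R| + ‖C‖) * r) + 2 * (K₂ * inner ℝ X w.snd)) := by gcongr
    _ ≤ K₁ ^ 2 * ((2 * (K₃ * |R| + ‖C‖) + 2 * K₂) * (inner ℝ X w.snd + r)) := by
      gcongr
      have h4 : 0 ≤ (K₃ * |R| + ‖C‖) * inner ℝ X w.snd := by positivity
      have h5 : 0 ≤ K₂ * r := by positivity
      linarith
    _ = _ := by ring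

/-- Quadratic growth at arbitrary points, in terms of any positive semidefinite matrix `S` near the
matrix part. -/
theorem exists_infDist_sq_le {A : Fin m → SymMat n} {C X P : SymMat n}
    {w₀ : DualSpace m n} {c μ : ℝ} (hc : 0 < c) (hμ : 0 < μ)
    (hPP : P.toMat * P.toMat = P.toMat) (hX : X - c • P ∈ psdCone n)
    (hw₀ : constraintMap A w₀ = C) (hPw₀ : P.toMat * w₀.snd.toMat = 0)
    (hZ₀ : w₀.snd - μ • (idMat n - P) ∈ psdCone n) {Ω : Set (DualSpace m n)}
    (hΩ : ∀ v : DualSpace m n, constraintMap A v = C → v.snd ∈ psdCone n →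
      P.toMat * v.snd.toMat = 0 → v ∈ Ω) (R : ℝ) :
    ∃ K : ℝ, 0 < K ∧ ∀ w : DualSpace m n, ∀ S ∈ psdCone n, ‖w‖ ≤ R → ‖S - w.snd‖ ≤ R →
      Metric.infDist w Ω ^ 2 ≤
        K * (inner ℝ X S + ‖C - adjA A w.fst - w.snd‖ + ‖S - w.snd‖) := by
  obtain ⟨K, hK, h⟩ := exists_dist_sq_le_of_mem_psdCone hc hμ hPP hX hw₀ hPw₀ hZ₀ (R + R)
  refine ⟨2 * K + 2 * |R|, by positivity, fun w S hS hwR hSR => ?_⟩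
  set w' : DualSpace m n := WithLp.toLp 2 (w.fst, S) with hw'
  have hw'S : w'.snd = S := rfl
  have hdist : ‖w' - w‖ = ‖S - w.snd‖ := by
    rw [WithLp.prod_norm_eq_of_L2]
    simp [hw']
  have hw'R : ‖w'‖ ≤ R + R := by
    have := norm_add_le w (w' - w)
    rw [add_sub_cancel, hdist] at this
    linarith
  obtain ⟨v, hv1, hv2, hv3, hv4⟩ := h w' hw'R hS
  rw [hw'S] at hv4
  set e := ‖S - w.snd‖ with he
  set r := ‖C - adjA A w.fst - w.snd‖ with hr
  have he0 : 0 ≤ e := norm_nonneg _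
  have hr0 : 0 ≤ r := norm_nonneg _
  have hr' : ‖constraintMap A w' - C‖ ≤ r + e := by
    have : constraintMap A w' - C = -(C - adjA A w.fst - w.snd) + (S - w.snd) := by
      rw [constraintMap_apply, show w'.fst = w.fst from rfl, hw'S]
      abel
    rw [this]
    refine (norm_add_le _ _).trans ?_
    rw [norm_neg]
  have h1 : Metric.infDist w Ω ≤ e + dist w' v := by
    refine (Metric.infDist_le_dist_of_mem (hΩ v hv1 hv2 hv3)).trans ?_
    refine (dist_triangle w w' v).trans ?_
    rw [dist_comm w w', dist_eq_norm w' w, hdist]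
  have he2 : e ^ 2 ≤ |R| * e := by
    rw [sq]; gcongr; exact hSR.trans (le_abs_self R)
  have hXS : 0 ≤ inner ℝ X S := by
    have hP : P ∈ psdCone n := by
      have := Matrix.posSemidef_conjTranspose_mul_self P.toMat
      rwa [P.isHermitian.eq, hPP] at this
    have := add_mem_psdCone hX (smul_mem_psdCone hc.le hP)
    rw [sub_add_cancel] at this
    exact inner_nonneg this hS
  calc _ ≤ (e + dist w' v) ^ 2 := by gcongr; exact Metric.infDist_nonneg
    _ ≤ 2 * e ^ 2 + 2 * dist w' v ^ 2 := by nlinarith [sq_nonneg (e - dist w' v)]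
    _ ≤ 2 * (|R| * e) + 2 * (K * (inner ℝ X S + (r + e))) := by
      gcongr
      exact hv4.trans (by gcongr)
    _ ≤ _ := by
      have h2 : 0 ≤ |R| * (inner ℝ X S + r) := by positivity
      linarith

end SDP

/-! ### Projection onto the cone and exact penalties -/

namespace SymMat

variable {n : ℕ}

theorem isClosed_psdCone : IsClosed (psdCone n) := by
  have : psdCone n = ⋂ x : Fin n → ℝ, {X | 0 ≤ inner ℝ X (rankOne x)} := by
    ext X
    simp only [Set.mem_iInter, Set.mem_ofPred_eq]
    exact ⟨fun h x => inner_nonneg h (rankOne_mem_psdCone x),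
      mem_psdCone_of_inner_rankOne_nonneg⟩
  rw [this]
  exact isClosed_iInter fun x =>
    isClosed_le continuous_const (continuous_id.inner continuous_const)

theorem exists_mem_psdCone_norm_sub_eq_infDist (Z : SymMat n) :
    ∃ S ∈ psdCone n, ‖S - Z‖ = Metric.infDist Z (psdCone n) ∧ ‖S - Z‖ ≤ ‖Z‖ := by
  have : ProperSpace (SymMat n) := FiniteDimensional.proper_real _
  obtain ⟨S, hS, h⟩ := isClosed_psdCone.exists_infDist_eq_dist ⟨0, zero_mem_psdCone⟩ Z
  have h1 : ‖S - Z‖ = Metric.infDist Z (psdCone n) := by rw [h, dist_comm, dist_eq_norm]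
  refine ⟨S, hS, h1, ?_⟩
  rw [h1]
  simpa using Metric.infDist_le_dist_of_mem (x := Z) (zero_mem_psdCone (n := n))

/-- The two properties of the function `h` in the dual cost on which the growth estimates rest:
where `h` is finite, it is at least `ρ ε` for some shift `ε` that makes the matrix positive
semidefinite, and it is star-convex with respect to every positive semidefinite matrix. -/
structure IsExactPenalty (ρ : ℝ) (h : SymMat n → EReal) : Prop where
  eq_top_or : ∀ Z, h Z = ⊤ ∨ ∃ s ε : ℝ, h Z = s ∧ 0 ≤ ε ∧ ε ≤ ‖Z‖ ∧
    Z + ε • idMat n ∈ psdCone n ∧ ρ * ε ≤ s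
  star_convex : ∀ Z₀ ∈ psdCone n, ∀ Z : SymMat n, ∀ s t : ℝ, h Z = s → 0 ≤ t → t ≤ 1 →
    ∃ s' : ℝ, h (Z₀ + t • (Z - Z₀)) = s' ∧ s' ≤ t * s

theorem convexCombination_mem_psdCone {Z₀ Z : SymMat n} {t : ℝ} (hZ₀ : Z₀ ∈ psdCone n)
    (hZ : Z ∈ psdCone n) (h0 : 0 ≤ t) (h1 : t ≤ 1) : Z₀ + t • (Z - Z₀) ∈ psdCone n := by
  have := add_mem_psdCone (smul_mem_psdCone (sub_nonneg.mpr h1) hZ₀) (smul_mem_psdCone h0 hZ)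
  convert this using 1
  module

theorem isExactPenalty_psdIndicator (ρ : ℝ) : IsExactPenalty ρ (psdIndicator (n := n)) where
  eq_top_or Z := by
    by_cases hZ : Z ∈ psdCone n
    · exact Or.inr ⟨0, 0, by simp [psdIndicator, hZ], le_rfl, norm_nonneg Z, by simpa using hZ,
        by simp⟩
    · exact Or.inl (by simp [psdIndicator, hZ])
  star_convex Z₀ hZ₀ Z s t hs h0 h1 := by
    by_cases hZ : Z ∈ psdCone n
    · have hs0 : s = 0 := by
        simp only [psdIndicator, hZ, if_true] at hs
        exact_mod_cast hs.symm
      exact ⟨0, by simp [psdIndicator, convexCombination_mem_psdCone hZ₀ hZ h0 h1],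
        by simp [hs0]⟩
    · simp [psdIndicator, hZ] at hs

theorem isExactPenalty_psdPenalty {ρ : ℝ} (hρ : 0 ≤ ρ) :
    IsExactPenalty ρ (psdPenalty (n := n) ρ) where
  eq_top_or Z := by
    refine Or.inr ⟨_, max 0 (lamMax (-Z)), rfl, le_max_left _ _, ?_, ?_, le_rfl⟩
    · exact max_le (norm_nonneg Z)
        ((lamMax_neg_le_iff (norm_nonneg Z)).mpr (add_smul_idMat_mem_psdCone le_rfl))
    · exact (lamMax_neg_le_iff (le_max_left _ _)).mp (le_max_right _ _)
  star_convex Z₀ hZ₀ Z s t hs h0 h1 := by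
    refine ⟨_, rfl, ?_⟩
    have hs' : s = ρ * max 0 (lamMax (-Z)) := (EReal.coe_eq_coe_iff.mp hs).symm
    set ε := max 0 (lamMax (-Z)) with hε
    have hε0 : 0 ≤ ε := le_max_left _ _
    have h2 : Z + ε • idMat n ∈ psdCone n :=
      (lamMax_neg_le_iff hε0).mp (le_max_right _ _)
    have h3 : max 0 (lamMax (-(Z₀ + t • (Z - Z₀)))) ≤ t * ε := by
      refine max_le (by positivity) ((lamMax_neg_le_iff (by positivity)).mpr ?_)
      convert convexCombination_mem_psdCone hZ₀ h2 h0 h1 using 1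
      module
    calc _ ≤ ρ * (t * ε) := mul_le_mul_of_nonneg_left h3 hρ
      _ = t * s := by rw [hs']; ring

end SymMat

/-! ### Growth of the dual cost -/

namespace SDP

open SymMat

variable {m n : ℕ} {A : Fin m → SymMat n} {b : EuclideanSpace ℝ (Fin m)} {C : SymMat n}

theorem mem_dualSol_iff {d : ℝ} (hd : dualValue A b C = d) {w : DualSpace m n} :
    w ∈ dualSol A b C ↔ inner ℝ b w.fst = d ∧ constraintMap A w = C ∧ w.snd ∈ psdCone n := by
  rw [dualSol, Set.mem_ofPred_eq, hd, EReal.coe_eq_coe_iff]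
  rfl

/-- The duality gap at `w = (y, Z)`, as a perturbation of the complementarity term `⟨X, Z⟩`. -/
theorem dualityGap_eq {X : SymMat n} (hX : opA A X = b) {d : ℝ} (hd : inner ℝ C X = d)
    (w : DualSpace m n) :
    d - inner ℝ b w.fst = inner ℝ X w.snd + inner ℝ X (C - adjA A w.fst - w.snd) := by
  rw [← hX, inner_opA, ← hd, inner_sub_right, inner_sub_right, real_inner_comm X C]
  ring

/-- Growth estimates on bounded sets, in real numbers. -/
theorem exists_growth_of_norm_le {X : SymMat n} {w₀ : DualSpace m n} {d ρ : ℝ}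
    (hX : opA A X = b) (hCX : inner ℝ C X = d) (hd : dualValue A b C = d)
    (hw₀ : w₀ ∈ dualSol A b C)
    (hsc : X ∈ intrinsicInterior ℝ (normalCone (polarCone (psdCone n)) (-w₀.snd)))
    (hρ : X.tr < ρ) {h : SymMat n → EReal} (hh : IsExactPenalty ρ h) (R : ℝ) :
    ∃ K γ : ℝ, 0 < K ∧ 0 < γ ∧ ∀ w : DualSpace m n, ‖w‖ ≤ R →
      (∀ s : ℝ, h w.snd = s → Metric.infDist w (dualSol A b C) ^ 2 ≤
        K * (d - inner ℝ b w.fst + s + γ * ‖C - adjA A w.fst - w.snd‖)) ∧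
      Metric.infDist w (dualSol A b C) ^ 2 ≤
        K * (d - inner ℝ b w.fst + γ * ‖C - adjA A w.fst - w.snd‖ +
          γ * Metric.infDist w.snd (psdCone n)) := by
  obtain ⟨-, hw₀C, hw₀psd⟩ := (mem_dualSol_iff hd).mp hw₀
  obtain ⟨P, hPP, hPZ, hXP, ⟨c, hc, hXc⟩, μ, hμ, hZμ⟩ :=
    exists_projector_of_mem_intrinsicInterior_normalCone hw₀psd hsc
  have hXpsd := (mem_psdCone_of_mem_normalCone (intrinsicInterior_subset hsc)).1
  have hΩ : ∀ v : DualSpace m n, constraintMap A v = C → v.snd ∈ psdCone n →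
      P.toMat * v.snd.toMat = 0 → v ∈ dualSol A b C := by
    intro v hv1 hv2 hv3
    refine (mem_dualSol_iff hd).mpr ⟨?_, hv1, hv2⟩
    have h1 := dualityGap_eq hX hCX v
    have h2 : C - adjA A v.fst - v.snd = 0 := by
      rw [← hv1, constraintMap_apply]; abel
    have h3 : inner ℝ X v.snd = 0 := by
      rw [inner_eq_trace_mul, ← hXP, Matrix.mul_assoc, hv3, Matrix.mul_zero, Matrix.trace_zero]
    rw [h2, h3, inner_zero_right] at h1
    linarith
  -- The radius also has to bound the distance from `Z` to its shift `Z + ε I`, where `ε ≤ ‖Z‖`.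
  obtain ⟨K, hK, hgrowth⟩ := exists_infDist_sq_le hc hμ hPP hXc hw₀C hPZ hZμ hΩ
    (|R| * (1 + ‖idMat n‖))
  have hρ' : 0 < ρ - X.tr := sub_pos.mpr hρ
  set M : ℝ := 1 + ‖idMat n‖ / (ρ - X.tr) with hM
  have hM1 : 1 ≤ M := le_add_of_nonneg_right (by positivity)
  refine ⟨K * M, 1 + ‖X‖, by positivity, by positivity, fun w hwR => ?_⟩
  have hwR' : ‖w‖ ≤ |R| := hwR.trans (le_abs_self R)
  have hwR'' : ‖w‖ ≤ |R| * (1 + ‖idMat n‖) :=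
    hwR'.trans (le_mul_of_one_le_right (abs_nonneg R) (le_add_of_nonneg_right (norm_nonneg _)))
  have hZR : ‖w.snd‖ ≤ |R| := (WithLp.norm_snd_le_of_L2 w).trans hwR'
  have hgap := dualityGap_eq hX hCX w
  set r := ‖C - adjA A w.fst - w.snd‖ with hr
  have hr0 : 0 ≤ r := norm_nonneg _
  have hXr := (abs_le.mp (abs_real_inner_le_norm X (C - adjA A w.fst - w.snd))).1
  rw [← hr] at hXr
  refine ⟨fun s hs => ?_, ?_⟩
  · obtain htop | ⟨s', ε, hs', hε0, hεZ, hpsd, hle⟩ := hh.eq_top_or w.snd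
    · simp [htop] at hs
    obtain rfl : s = s' := by rw [hs] at hs'; exact_mod_cast hs'
    have hnorm : ‖w.snd + ε • idMat n - w.snd‖ = ε * ‖idMat n‖ := by
      rw [add_sub_cancel_left, norm_smul, Real.norm_of_nonneg hε0]
    have h1 := hgrowth w _ hpsd hwR'' (by
      rw [hnorm]
      have : ε ≤ |R| := hεZ.trans hZR
      have : ε * ‖idMat n‖ ≤ |R| * ‖idMat n‖ := by gcongr
      have : 0 ≤ |R| := abs_nonneg R
      linarith)
    have h2 : inner ℝ X (w.snd + ε • idMat n) = inner ℝ X w.snd + ε * X.tr := by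
      rw [inner_add_right, real_inner_smul_right, inner_idMat]
    have h3 := inner_nonneg hXpsd hpsd
    rw [hnorm, h2] at h1
    rw [h2] at h3
    refine h1.trans ?_
    rw [mul_assoc]
    refine mul_le_mul_of_nonneg_left ?_ hK.le
    -- The slack `(ρ - tr X) ε` of the penalty absorbs the distance `ε ‖I‖`.
    calc _ ≤ M * (inner ℝ X w.snd + ε * X.tr + r + (ρ - X.tr) * ε) := by
          have h4 : M * ((ρ - X.tr) * ε) = (ρ - X.tr) * ε + ε * ‖idMat n‖ := by
            rw [hM]; field_simp
          have h5 := mul_le_mul_of_nonneg_right hM1 (add_nonneg h3 hr0)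
          have h6 : 0 ≤ (ρ - X.tr) * ε := by positivity
          rw [mul_add, h4]
          linarith
      _ ≤ _ := by
          refine mul_le_mul_of_nonneg_left ?_ (zero_le_one.trans hM1)
          linarith
  · obtain ⟨S, hS, hSe, hSZ⟩ := exists_mem_psdCone_norm_sub_eq_infDist w.snd
    have h1 := hgrowth w S hS hwR'' (hSZ.trans ((WithLp.norm_snd_le_of_L2 w).trans hwR''))
    have h2 : inner ℝ X S = inner ℝ X w.snd + inner ℝ X (S - w.snd) := by
      rw [← inner_add_right, add_sub_cancel]
    have h3 := real_inner_le_norm X (S - w.snd)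
    have h4 := inner_nonneg hXpsd hS
    rw [← hSe]
    refine h1.trans ?_
    rw [mul_assoc]
    refine mul_le_mul_of_nonneg_left ?_ hK.le
    refine (le_mul_of_one_le_left ?_ hM1).trans (mul_le_mul_of_nonneg_left ?_ (by positivity))
    · positivity
    · linarith

/-- Growth estimates on bounded sets. -/
theorem dualGrowthOn_of_norm_le {X : SymMat n} {w₀ : DualSpace m n} {d ρ : ℝ}
    (hX : opA A X = b) (hCX : inner ℝ C X = d) (hd : dualValue A b C = d)
    (hw₀ : w₀ ∈ dualSol A b C)
    (hsc : X ∈ intrinsicInterior ℝ (normalCone (polarCone (psdCone n)) (-w₀.snd)))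
    (hρ : X.tr < ρ) {h : SymMat n → EReal} (hh : IsExactPenalty ρ h)
    {V : Set (DualSpace m n)} {R : ℝ} (hV : ∀ w ∈ V, ‖w‖ ≤ R) :
    DualGrowthOn A b C h V := by
  obtain ⟨K, γ, hK, hγ, hgrowth⟩ := exists_growth_of_norm_le hX hCX hd hw₀ hsc hρ hh R
  refine ⟨K⁻¹, γ, γ, inv_pos.mpr hK, hγ, hγ, fun w hw => ?_, fun w hw => ?_⟩
  · rw [dualCost, hd]
    obtain htop | ⟨s, -, hs, -⟩ := hh.eq_top_or w.snd
    · rw [htop, EReal.coe_add_top, EReal.top_add_coe, EReal.top_add_coe]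
      exact le_top
    · have := (hgrowth w (hV w hw)).1 s hs
      rw [hs]
      norm_cast
      rw [inv_mul_le_iff₀ hK]
      refine this.trans (le_of_eq ?_)
      ring
  · rw [hd]
    norm_cast
    rw [inv_mul_le_iff₀ hK]
    exact (hgrowth w (hV w hw)).2

/-- On the sphere around `w₀` of a radius that keeps it at distance `1` from the solution set,
growth bounds the excess of the cost from below. Star-convexity propagates this bound to a linear
growth of the cost outside the ball. -/
theorem exists_norm_le_of_mem_dualSublevel {X : SymMat n} {w₀ : DualSpace m n} {d ρ : ℝ}
    (hX : opA A X = b) (hCX : inner ℝ C X = d) (hd : dualValue A b C = d)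
    (hw₀ : w₀ ∈ dualSol A b C)
    (hsc : X ∈ intrinsicInterior ℝ (normalCone (polarCone (psdCone n)) (-w₀.snd)))
    (hρ : X.tr < ρ) {h : SymMat n → EReal} (hh : IsExactPenalty ρ h)
    (hΩ : IsCompact (dualSol A b C)) (β : ℝ) :
    ∃ R : ℝ, ∀ w ∈ dualSublevel A b C h β, ‖w‖ ≤ R := by
  obtain ⟨hb₀, hw₀C, hw₀psd⟩ := (mem_dualSol_iff hd).mp hw₀
  obtain ⟨R₀, hR₀⟩ := (Metric.isBounded_iff_subset_closedBall w₀).mp hΩ.isBounded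
  have hR₀0 : 0 ≤ R₀ := by simpa using hR₀ hw₀
  set R := R₀ + 1 with hR
  have hR0 : 0 < R := by positivity
  obtain ⟨K, γ, hK, hγ, hgrowth⟩ :=
    exists_growth_of_norm_le hX hCX hd hw₀ hsc hρ hh (‖w₀‖ + R)
  refine ⟨‖w₀‖ + max R (K * R * (d + β)), fun w ⟨hwβ, hwC⟩ => ?_⟩
  have hwC' : constraintMap A w = C := hwC
  suffices hD : ‖w - w₀‖ ≤ max R (K * R * (d + β)) by
    have := norm_add_le w₀ (w - w₀)
    rw [add_sub_cancel] at this
    linarith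
  by_contra! hlt
  obtain ⟨hlt1, hlt2⟩ := max_lt_iff.mp hlt
  set D := ‖w - w₀‖ with hD
  have hD0 : 0 < D := hR0.trans hlt1
  obtain ⟨s, hs, hsβ⟩ : ∃ s : ℝ, h w.snd = s ∧ -inner ℝ b w.fst + s ≤ β := by
    obtain htop | ⟨s, -, hs, -⟩ := hh.eq_top_or w.snd
    · simp [dualCost, htop] at hwβ
    · refine ⟨s, hs, ?_⟩
      rw [dualCost, hs] at hwβ
      exact_mod_cast hwβ
  have ht0 : 0 ≤ R / D := by positivity
  have ht1 : R / D ≤ 1 := (div_le_one hD0).mpr hlt1.le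
  obtain ⟨s', hs', hss'⟩ := hh.star_convex w₀.snd hw₀psd w.snd s (R / D) hs ht0 ht1
  set w' : DualSpace m n := w₀ + (R / D) • (w - w₀) with hw'
  have hnorm : ‖w' - w₀‖ = R := by
    rw [hw', add_sub_cancel_left, norm_smul, Real.norm_of_nonneg ht0, ← hD,
      div_mul_cancel₀ _ hD0.ne']
  have hw'R : ‖w'‖ ≤ ‖w₀‖ + R := by
    have := norm_add_le w₀ (w' - w₀)
    rwa [add_sub_cancel, hnorm] at this
  have hw'C : constraintMap A w' = C := by
    rw [hw', map_add, map_smul, map_sub, hwC', hw₀C, sub_self, smul_zero, add_zero]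
  have hdist : 1 ≤ Metric.infDist w' (dualSol A b C) := by
    refine (Metric.le_infDist ⟨w₀, hw₀⟩).mpr fun v hv => ?_
    have h2 : dist w₀ v ≤ R₀ := by rw [dist_comm]; exact hR₀ hv
    have h3 : dist w' w₀ ≤ dist w' v + dist w₀ v := by
      rw [dist_comm w₀ v]; exact dist_triangle w' v w₀
    rw [dist_eq_norm w' w₀, hnorm] at h3
    linarith
  have hg := (hgrowth w' hw'R).1 s' hs'
  have hres : C - adjA A w'.fst - w'.snd = 0 := by
    rw [sub_sub, ← constraintMap_apply, hw'C, sub_self]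
  have hb' : inner ℝ b w'.fst = d + R / D * (inner ℝ b w.fst - d) := by
    rw [hw', WithLp.add_fst, WithLp.smul_fst, WithLp.sub_fst, inner_add_right,
      real_inner_smul_right, inner_sub_right, hb₀]
  rw [hres, norm_zero, mul_zero, add_zero, hb'] at hg
  have h1 : 1 ≤ K * (R / D * (d + β)) := by
    calc (1 : ℝ) ≤ Metric.infDist w' (dualSol A b C) ^ 2 := one_le_pow₀ hdist
      _ ≤ _ := hg
      _ ≤ _ := by
        refine mul_le_mul_of_nonneg_left ?_ hK.le
        have := mul_le_mul_of_nonneg_left hsβ ht0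
        linarith
  have h2 : K * (R / D * (d + β)) = K * R * (d + β) / D := by ring
  rw [h2, le_div_iff₀ hD0, one_mul] at h1
  exact absurd h1 (not_le.mpr hlt2)

end SDP

end

theorem mainTheorem3 (m n : ℕ) (A : Fin m → SymMat n) (b : EuclideanSpace ℝ (Fin m)) (C : SymMat n)
    (hA : Function.Surjective (SDP.opA A))
    (hsd : SDP.StrongDuality A b C)
    (Xbar : SymMat n) (ybar : EuclideanSpace ℝ (Fin m)) (Zbar : SymMat n)
    (hsc : SDP.DualStrictCompl A b C Xbar ybar Zbar)
    (ρ : ℝ) (hρ : Xbar.tr < ρ)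
    (h : SymMat n → EReal) (hh : h = SymMat.psdIndicator ∨ h = SymMat.psdPenalty ρ) :
    (∀ V : Set (SDP.DualSpace m n), IsCompact V → (V ∩ SDP.dualSol A b C).Nonempty →
      SDP.DualGrowthOn A b C h V) ∧
    (IsCompact (SDP.dualSol A b C) → ∀ β : ℝ,
      SDP.DualGrowthOn A b C h (SDP.dualSublevel A b C h β)) := by
  obtain ⟨⟨hXval, hXeq, hXpsd⟩, hw₀, hint⟩ := hsc
  have hd : SDP.dualValue A b C = ((inner ℝ b ybar : ℝ) : EReal) := hw₀.1.symm
  have hCX : inner ℝ C Xbar = (inner ℝ b ybar : ℝ) := by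
    rw [← EReal.coe_eq_coe_iff, hXval, ← hd]
    exact hsd
  have hρ0 : 0 ≤ ρ := (hXpsd.trace_nonneg).trans hρ.le
  have hh' : SymMat.IsExactPenalty ρ h := by
    rcases hh with rfl | rfl
    · exact SymMat.isExactPenalty_psdIndicator ρ
    · exact SymMat.isExactPenalty_psdPenalty hρ0
  constructor
  · intro V hV _
    obtain ⟨R, hR⟩ := hV.isBounded.exists_norm_le
    exact SDP.dualGrowthOn_of_norm_le hXeq hCX hd hw₀ hint hρ hh' hR
  · intro hΩ β
    obtain ⟨R, hR⟩ :=
      SDP.exists_norm_le_of_mem_dualSublevel hXeq hCX hd hw₀ hint hρ hh' hΩ β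
    exact SDP.dualGrowthOn_of_norm_le hXeq hCX hd hw₀ hint hρ hh' hR
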